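/- Let $n,c\ge 0$ be integers. There is an integer $N$, depending only on $n$ and $c$, with the following property. Let $K$ be a field, let $X$ be a finite set with formal inverses $\overline X=\{\overline x : x\in X\}$ such that the doubled alphabet $A=X\cup\overline X$ has $c$ elements, and let $\Gamma$ be the free group on $X$, equipped with a total order such that $a<b$ implies $uav<ubv$ for all $a,b,u,v\in\Gamma$. Let $S=\sum_{w\in A^*}(S,w)\,w$ be a rational series over $A^*$ with coefficients in $K$, i.e. a member of the smallest class of formal series that contains the noncommutative polynomials and is closed under sums, Cauchy products and the star operation $T\mapsto T^*=1+T+T^2+\cdots$ for series $T$ without constant term. Assume that $S$ has Hankel rank $n$, i.e. the right translates $\sum_{w\in A^*}(S,wu)\,w$ $(u\in A^*)$ span a $K$-vector space of dimension $n$; that every word in the support $\operatorname{supp}S=\{w : (S,w)\neq 0\}$ is reduced (contains no factor $x\overline x$ or $\overline x x$ with $x\in X$); and that $\operatorname{supp} S$, viewed as a subset of $\Gamma$ by identifying reduced words with elements of $\Gamma$, is well-ordered. Then every word $w\in\operatorname{supp}S$ of length at least $N$ can be written as a concatenation $w=p\,u_1u_2\cdots u_n\,s$ of words in $A^*$ such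 that $u_i>1$ in $\Gamma$ for every $i=1,\dots,n$. -/

import Mathlib

/-- A formal series over the free monoid `A*` with coefficients in `K`. Words are lists of letters,
and `S w` is the coefficient `(S, w)`. -/
abbrev WordSeries (K A : Type*) := List A → K

namespace WordSeries

section
variable {K A : Type*} [Field K]

/-- The series `1`: coefficient `1` at the empty word and `0` elsewhere. -/
def unit : WordSeries K A
  | [] => 1
  | _ :: _ => 0

/-- The Cauchy product: `(ST, w)` is the sum of `(S, p) (T, s)` over all factorizations `w = ps`. -/
def cauchyMul (S T : WordSeries K A) : WordSeries K A := fun w =>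
  ∑ i ∈ Finset.range (w.length + 1), S (w.take i) * T (w.drop i)

/-- Powers for the Cauchy product. -/
def cauchyPow (S : WordSeries K A) : ℕ → WordSeries K A
  | 0 => unit
  | k + 1 => cauchyMul S (cauchyPow S k)

/-- If `S` has no constant term, then `S ^ k` vanishes on words shorter than `k`; hence only
finitely many powers contribute to each coefficient of `1 + S + S ^ 2 + ⋯`. -/
theorem cauchyPow_eq_zero (S : WordSeries K A) (hS : S [] = 0) (k : ℕ) :
    ∀ w : List A, w.length < k → cauchyPow S k w = 0 := by
  induction k with
  | zero => intro w hw; omega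
  | succ k ih =>
    intro w hw
    rw [cauchyPow, cauchyMul]
    refine Finset.sum_eq_zero fun i hi => ?_
    rcases Nat.eq_zero_or_pos i with rfl | hpos
    · simp [hS]
    · by_cases hk : k = 0
      · have hw0 : w = [] := List.length_eq_zero_iff.mp (by omega)
        subst hw0
        simp [hS]
      · rw [ih _ (by rw [List.length_drop]; omega), mul_zero]

/-- The star `S* = 1 + S + S ^ 2 + ⋯`, used only for series without constant term, where each
coefficient is a finite sum. -/
noncomputable def star (S : WordSeries K A) : WordSeries K A := fun w =>
  ∑ᶠ k : ℕ, cauchyPow S k w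

/-- Rational series over `A*`: the smallest class of series that contains the noncommutative
polynomials and is closed under sum, Cauchy product, and star of series without constant term. -/
inductive IsRational : WordSeries K A → Prop
  | poly (p : List A →₀ K) : IsRational (fun w => p w)
  | add (S T : WordSeries K A) : IsRational S → IsRational T → IsRational (fun w => S w + T w)
  | mul (S T : WordSeries K A) : IsRational S → IsRational T → IsRational (cauchyMul S T)
  | star (S : WordSeries K A) : IsRational S → S [] = 0 → IsRational (star S)

/-- The right translate of `S` by the word `u`: its coefficient at `w` is `(S, wu)`. -/
def rightTranslate (u : List A) (S : WordSeries K A) : WordSeries K A := fun w => S (w ++ u)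

/-- The Hankel operator of `S`: the linear map from polynomials to series that sends a word `u` to
the right translate of `S` by `u`. -/
noncomputable def hankelOperator (S : WordSeries K A) : (List A →₀ K) →ₗ[K] WordSeries K A :=
  Finsupp.linearCombination K (fun u : List A => rightTranslate u S)

/-- The Hankel rank of `S`: the rank of its Hankel operator, i.e. the dimension of the space spanned
by all right translates of `S`. -/
noncomputable def hankelRank (S : WordSeries K A) : Cardinal := (hankelOperator S).rank

end

end WordSeries

/-! Erdős–Szekeres is played against pumping. The prefixes of a reduced word are distinct in Γ. A
long word of the support therefore has either `n` increasing steps among its prefix values, whose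
quotients are the factors sought, or `M` decreasing steps, which cut out factors less than 1.

The second case is impossible. The series is represented on the `n`-dimensional span of its right
translates by operators μ(w). A factor v for which μ(v) has disjoint kernel and range can be pumped
infinitely often (`exists_apply_pow_ne_zero`), so v < 1 would give an infinite descent in the
support. Among `M` consecutive factors such a v exists: if every contiguous subproduct had
intersecting kernel and range, the whole product would vanish (`exists_forall_cocycle_eq_zero`), and
so would the coefficient of the word. The vanishing is proved by lowering the rank one unit at a
time; at constant rank a skew Bollobás inequality bounds the number of blocks. -/

/-! ### Kernels and ranges of products of endomorphisms -/

section LinearAlgebra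

open Module

variable {K V : Type*} [Field K] [AddCommGroup V] [Module K V] [FiniteDimensional K V]

/-- If the kernel and the range of `m` are disjoint, then a sequence `k ↦ f (m ^ k x)` that is
nonzero at `k = 1` is nonzero infinitely often. -/
theorem exists_apply_pow_ne_zero {m : End K V} (hm : Disjoint (LinearMap.ker m) (LinearMap.range m))
    (f : V →ₗ[K] K) (x : V) (hx : f (m x) ≠ 0) (k₀ : ℕ) : ∃ k ≥ k₀, f ((m ^ k) x) ≠ 0 := by
  by_contra! h
  -- The exponent starts at `k + 1` so that `W k` lies in the range of `m`, where `m` is injective.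
  -- Hence `m` preserves its dimension, and the decreasing sequence `W` is constant.
  let W : ℕ → Submodule K V := fun k => Submodule.span K (Set.range fun j => (m ^ (k + j + 1)) x)
  have hWm : ∀ k, (W k).map m = W (k + 1) := by
    intro k
    simp only [W, Submodule.map_span, ← Set.range_comp]
    congr 2
    ext j
    simp only [Function.comp_apply, ← Module.End.mul_apply, ← pow_succ']
    congr 2
    ring
  have hWr : ∀ k, W k ≤ LinearMap.range m := by
    intro k
    rw [Submodule.span_le]
    rintro _ ⟨j, rfl⟩
    exact ⟨(m ^ (k + j)) x, by rw [← Module.End.mul_apply, ← pow_succ']⟩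
  have hWle : ∀ k, W (k + 1) ≤ W k := by
    intro k
    rw [Submodule.span_le]
    rintro _ ⟨j, rfl⟩
    refine Submodule.subset_span ⟨j + 1, ?_⟩
    simp only
    congr 2
    ring
  have hWeq : ∀ k, W (k + 1) = W k := by
    intro k
    refine Submodule.eq_of_le_of_finrank_eq (hWle k) ?_
    rw [← hWm k, ← LinearMap.range_domRestrict]
    refine LinearMap.finrank_range_of_inj ?_
    have hinj := LinearMap.injOn_of_disjoint_ker (le_refl (LinearMap.range m : Set V)) hm.symm
    exact fun a b hab => Subtype.ext (hinj (hWr k a.2) (hWr k b.2) hab)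
  have hW : ∀ k, W k = W 0 := by
    intro k
    induction k with
    | zero => rfl
    | succ k ih => rw [hWeq, ih]
  have hmem : m x ∈ W k₀ := by
    rw [hW]
    exact Submodule.subset_span ⟨0, by simp⟩
  have hle : W k₀ ≤ LinearMap.ker f := by
    rw [Submodule.span_le]
    rintro _ ⟨j, rfl⟩
    exact h _ (by omega)
  exact hx (hle hmem)

/-- The determinant of a product of rectangular matrices, as a sum of terms in which the two factors
are separated. -/
theorem det_mul_eq_sum {K ι κ : Type*} [CommRing K] [Fintype ι] [DecidableEq ι] [Fintype κ]
    (A : Matrix ι κ K) (B : Matrix κ ι K) :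
    (A * B).det = ∑ f : ι → κ, (A.submatrix id f).det * ∏ i, B (f i) i := by
  classical
  simp only [Matrix.det_apply', Matrix.mul_apply, Finset.prod_univ_sum, Finset.mul_sum,
    Fintype.piFinset_univ, Finset.sum_mul]
  rw [Finset.sum_comm]
  refine Finset.sum_congr rfl fun f _ => Finset.sum_congr rfl fun σ _ => ?_
  simp [Finset.prod_mul_distrib, mul_assoc]

/-- A skew Bollobás bound for pairs of maps into and out of an `n`-dimensional space. -/
theorem le_pow_of_det_comp_triangular {T r : ℕ} (R : Fin T → V →ₗ[K] (Fin r → K))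
    (C : Fin T → (Fin r → K) →ₗ[K] V)
    (hdiag : ∀ i, LinearMap.det (R i ∘ₗ C i) ≠ 0)
    (hlow : ∀ i j, j < i → LinearMap.det (R i ∘ₗ C j) = 0) :
    T ≤ finrank K V ^ r := by
  classical
  let b := finBasis K V
  let e := Pi.basisFun K (Fin r)
  -- The determinants form a `T × T` matrix that factors through an index set of size `n ^ r`.
  -- Triangularity makes it invertible, so `T ≤ n ^ r`.
  let A : Matrix (Fin T) (Fin r → Fin (finrank K V)) K := fun i f =>
    ((LinearMap.toMatrix b e (R i)).submatrix id f).det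
  let B : Matrix (Fin r → Fin (finrank K V)) (Fin T) K := fun f j =>
    ∏ i, LinearMap.toMatrix e b (C j) (f i) i
  have hAB : ∀ i j, (A * B) i j = LinearMap.det (R i ∘ₗ C j) := by
    intro i j
    rw [← LinearMap.det_toMatrix e, LinearMap.toMatrix_comp e b e, det_mul_eq_sum]
    rfl
  have htri : (A * B).IsUpperTriangular := fun i j hij => by rw [hAB]; exact hlow i j hij
  have hdet : (A * B).det ≠ 0 := by
    rw [Matrix.det_of_isUpperTriangular htri]
    exact Finset.prod_ne_zero_iff.mpr fun i _ => by rw [hAB]; exact hdiag i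
  have hrank := Matrix.rank_of_isUnit (A * B)
    ((Matrix.isUnit_iff_isUnit_det _).mpr (isUnit_iff_ne_zero.mpr hdet))
  have h1 := (Matrix.rank_mul_le_left A B).trans (Matrix.rank_le_card_width A)
  rw [hrank] at h1
  simpa using h1

/-- The skew Bollobás bound for the kernels and ranges of endomorphisms of rank `r`. -/
theorem le_pow_of_disjoint_ker_range_skew {T r : ℕ} (b : ℕ → End K V)
    (hr : ∀ i ≤ T, finrank K (LinearMap.range (b i)) = r)
    (hdiag : ∀ i < T, Disjoint (LinearMap.ker (b i)) (LinearMap.range (b (i + 1))))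
    (hlow : ∀ i j, i ≤ j → j < T → ¬ Disjoint (LinearMap.ker (b j)) (LinearMap.range (b i))) :
    T ≤ finrank K V ^ r := by
  have e : ∀ i : ℕ, i ≤ T → LinearMap.range (b i) ≃ₗ[K] (Fin r → K) := fun i hi =>
    LinearEquiv.ofFinrankEq _ _ (by rw [hr i hi, finrank_fin_fun])
  let R : ∀ i : ℕ, i ≤ T → V →ₗ[K] (Fin r → K) := fun i hi =>
    (e i hi).toLinearMap ∘ₗ (b i).rangeRestrict
  let C : ∀ i : ℕ, i ≤ T → (Fin r → K) →ₗ[K] V := fun i hi =>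
    (LinearMap.range (b i)).subtype ∘ₗ (e i hi).symm.toLinearMap
  have hR : ∀ i hi x, R i hi x = 0 ↔ b i x = 0 := by
    intro i hi x
    simp [R, ← Subtype.coe_inj]
  have key : ∀ i j (hi : i ≤ T) (hj : j ≤ T), LinearMap.det (R i hi ∘ₗ C j hj) ≠ 0 ↔
      Disjoint (LinearMap.ker (b i)) (LinearMap.range (b j)) := by
    intro i j hi hj
    rw [← isUnit_iff_ne_zero, ← LinearMap.isUnit_iff_isUnit_det, LinearMap.isUnit_iff_ker_eq_bot,
      LinearMap.ker_eq_bot', disjoint_comm, LinearMap.disjoint_ker]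
    constructor
    · intro h x hx hbx
      have h1 := h (e j hj ⟨x, hx⟩) ((hR i hi _).mpr (by simpa [C] using hbx))
      simpa using h1
    · intro h y hy
      have h1 := h (C j hj y) ((e j hj).symm y).2 ((hR i hi _).mp hy)
      simpa [C] using h1
  -- The shift pairs the kernel of `b i` with the range of `b (i + 1)` on the diagonal; this is why
  -- `T + 1` endomorphisms are needed.
  refine le_pow_of_det_comp_triangular (fun i : Fin T => R i i.2.le)
    (fun i : Fin T => C (i + 1) i.2) ?_ ?_
  · intro i
    exact (key _ _ _ _).mpr (hdiag i i.2)
  · intro i j hij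
    by_contra h
    exact hlow (j + 1) i hij i.2 ((key _ _ _ _).mp h)

/-- One step of the rank descent for cocycles of endomorphisms all of whose values have
intersecting kernel and range. -/
theorem finrank_range_le_of_finrank_range_le_succ {M r T : ℕ}
    (hM : ∀ E : ℕ → ℕ → End K V, (∀ i j k, i ≤ j → j ≤ k → E i k = E i j * E j k) →
      (∀ i j, i < j → j ≤ M → ¬ Disjoint (LinearMap.ker (E i j)) (LinearMap.range (E i j))) →
      finrank K (LinearMap.range (E 0 M)) ≤ r + 1)
    (hMpos : 0 < M) (hT : finrank K V ^ (r + 1) < T)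
    (E : ℕ → ℕ → End K V) (hE : ∀ i j k, i ≤ j → j ≤ k → E i k = E i j * E j k)
    (hdis : ∀ i j, i < j → j ≤ M * (T + 1) →
      ¬ Disjoint (LinearMap.ker (E i j)) (LinearMap.range (E i j))) :
    finrank K (LinearMap.range (E 0 (M * (T + 1)))) ≤ r := by
  by_contra! hlt
  have hle_left : ∀ i j k, i ≤ j → j ≤ k → LinearMap.range (E i k) ≤ LinearMap.range (E i j) := by
    intro i j k hij hjk
    rw [hE i j k hij hjk]
    exact LinearMap.range_comp_le_range _ _
  have hker : ∀ i j k, i ≤ j → j ≤ k → LinearMap.ker (E j k) ≤ LinearMap.ker (E i k) := by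
    intro i j k hij hjk
    rw [hE i j k hij hjk]
    exact LinearMap.ker_le_ker_comp _ _
  have hrank_left : ∀ i j k, i ≤ j → j ≤ k →
      finrank K (LinearMap.range (E i k)) ≤ finrank K (LinearMap.range (E i j)) :=
    fun i j k hij hjk => Submodule.finrank_mono (hle_left i j k hij hjk)
  have hrank_right : ∀ i j k, i ≤ j → j ≤ k →
      finrank K (LinearMap.range (E i k)) ≤ finrank K (LinearMap.range (E j k)) := by
    intro i j k hij hjk
    have h1 := Submodule.finrank_mono (hker i j k hij hjk)
    have h2 := LinearMap.finrank_range_add_finrank_ker (E j k)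
    have h3 := LinearMap.finrank_range_add_finrank_ker (E i k)
    omega
  have hblock : ∀ i < T + 1, finrank K (LinearMap.range (E (M * i) (M * (i + 1)))) ≤ r + 1 := by
    intro i hi
    have hi' : M * (i + 1) ≤ M * (T + 1) := Nat.mul_le_mul_left _ hi
    refine hM (fun a b => E (M * i + a) (M * i + b)) ?_ ?_
    · intro a b c hab hbc
      exact hE _ _ _ (by omega) (by omega)
    · intro a b hab hb
      exact hdis _ _ (by omega) (by rw [mul_add] at hi'; omega)
  -- If the total rank exceeds `r`, every product of consecutive blocks has rank exactly `r + 1`.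
  -- Its range is then that of its first block and its kernel that of its last.
  have hrank : ∀ i j, i < j → j ≤ T + 1 →
      finrank K (LinearMap.range (E (M * i) (M * j))) = r + 1 := by
    intro i j hij hj
    have hj' : M * j ≤ M * (T + 1) := Nat.mul_le_mul_left _ hj
    have hij' : M * (i + 1) ≤ M * j := Nat.mul_le_mul_left _ hij
    have hi' : M * i ≤ M * (i + 1) := Nat.mul_le_mul_left _ (by omega)
    refine le_antisymm ?_ ?_
    · exact (hrank_left _ _ _ hi' hij').trans (hblock i (by omega))
    · have h1 := hrank_left 0 (M * j) (M * (T + 1)) (by omega) hj'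
      have h2 := hrank_right 0 (M * i) (M * j) (by omega) (by omega)
      omega
  have hrange_eq : ∀ i j, i < j → j ≤ T + 1 → LinearMap.range (E (M * i) (M * j)) =
      LinearMap.range (E (M * i) (M * (i + 1))) := by
    intro i j hij hj
    refine Submodule.eq_of_le_of_finrank_eq (hle_left _ _ _ (Nat.mul_le_mul_left _ (by omega))
      (Nat.mul_le_mul_left _ hij)) ?_
    rw [hrank i j hij hj, hrank i (i + 1) (by omega) (by omega)]
  have hker_eq : ∀ i j, i ≤ j → j < T + 1 → LinearMap.ker (E (M * i) (M * (j + 1))) =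
      LinearMap.ker (E (M * j) (M * (j + 1))) := by
    intro i j hij hj
    refine (Submodule.eq_of_le_of_finrank_eq (hker _ _ _ (Nat.mul_le_mul_left _ hij)
      (Nat.mul_le_mul_left _ (by omega))) ?_).symm
    have h1 := LinearMap.finrank_range_add_finrank_ker (E (M * i) (M * (j + 1)))
    have h2 := LinearMap.finrank_range_add_finrank_ker (E (M * j) (M * (j + 1)))
    rw [hrank _ _ (by omega) (by omega)] at h1 h2
    omega
  refine absurd (le_pow_of_disjoint_ker_range_skew (T := T) (r := r + 1)
    (fun i => E (M * i) (M * (i + 1))) ?_ ?_ ?_) (not_le.mpr hT)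
  · intro i hi
    exact hrank _ _ (by omega) (by omega)
  -- Multiplying block `i + 1` by block `i` loses no rank, so no nonzero vector of its range is
  -- killed.
  · intro i hi
    rw [disjoint_comm, LinearMap.disjoint_ker]
    rintro _ ⟨y, rfl⟩ h
    have h1 : y ∈ LinearMap.ker (E (M * i) (M * (i + 1 + 1))) := by
      rw [hE (M * i) (M * (i + 1)) _ (Nat.mul_le_mul_left _ (by omega))
        (Nat.mul_le_mul_left _ (by omega))]
      exact h
    rwa [hker_eq i (i + 1) (by omega) (by omega)] at h1
  · intro i j hij hj
    have h1 := hdis (M * i) (M * (j + 1)) ((Nat.mul_lt_mul_left hMpos).mpr (by omega))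
      (Nat.mul_le_mul_left _ (by omega))
    rwa [hker_eq i j hij (by omega), hrange_eq i (j + 1) (by omega) (by omega)] at h1

/-- A product of sufficiently many endomorphisms of an `n`-dimensional space in which every
contiguous subproduct has intersecting kernel and range is zero; the bound depends on `n` only. -/
theorem exists_forall_cocycle_eq_zero.{u, v} (n : ℕ) :
    ∃ M : ℕ, ∀ (K : Type u) (V : Type v) [Field K] [AddCommGroup V] [Module K V] [FiniteDimensional K V],
      finrank K V = n → ∀ E : ℕ → ℕ → End K V, (∀ i j k, i ≤ j → j ≤ k → E i k = E i j * E j k) →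
      (∀ i j, i < j → j ≤ M → ¬ Disjoint (LinearMap.ker (E i j)) (LinearMap.range (E i j))) →
      E 0 M = 0 := by
  suffices h : ∀ d r : ℕ, r + d = n → ∃ M > 0,
      ∀ (K : Type u) (V : Type v) [Field K] [AddCommGroup V] [Module K V] [FiniteDimensional K V],
      finrank K V = n → ∀ E : ℕ → ℕ → End K V, (∀ i j k, i ≤ j → j ≤ k → E i k = E i j * E j k) →
      (∀ i j, i < j → j ≤ M → ¬ Disjoint (LinearMap.ker (E i j)) (LinearMap.range (E i j))) →
      finrank K (LinearMap.range (E 0 M)) ≤ r by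
    obtain ⟨M, -, hM⟩ := h n 0 (by omega)
    refine ⟨M, fun K V _ _ _ _ hV E hE hdis => ?_⟩
    have h0 := hM K V hV E hE hdis
    rwa [Nat.le_zero, Submodule.finrank_eq_zero, LinearMap.range_eq_bot] at h0
  intro d
  induction d with
  | zero =>
    intro r hr
    refine ⟨1, one_pos, fun K V _ _ _ _ hV E _ _ => ?_⟩
    have := Submodule.finrank_le (LinearMap.range (E 0 1))
    omega
  | succ d ih =>
    intro r hr
    obtain ⟨M, hMpos, hM⟩ := ih (r + 1) (by omega)
    -- `T = n ^ (r + 1) + 1` violates the Bollobás bound; `T + 1` blocks of length `M` are used.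
    refine ⟨M * (n ^ (r + 1) + 1 + 1), by positivity, fun K V _ _ _ _ hV E hE hdis => ?_⟩
    exact finrank_range_le_of_finrank_range_le_succ (hM K V hV) hMpos (by rw [hV]; omega) E hE hdis

end LinearAlgebra

/-! ### Monotone chains in finite sequences -/

section Chains

/-- `IncreasingChain g k i` says that `g` has an increasing chain with `k` steps ending at `i`. -/
def IncreasingChain {α : Type*} [LT α] (g : ℕ → α) : ℕ → ℕ → Prop
  | 0, _ => True
  | k + 1, i => ∃ j < i, IncreasingChain g k j ∧ g j < g i

/-- A version of the Erdős–Szekeres theorem: either there is an increasing chain with `n` steps, or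
there is a decreasing one with `M` steps. -/
theorem exists_increasingChain_or_strictAnti {α : Type*} [LinearOrder α] (g : ℕ → α) {n M L : ℕ}
    (hL : n * M < L) (hg : Set.InjOn g (Set.Iio L)) :
    (∃ i < L, IncreasingChain g n i) ∨
      ∃ t : Fin (M + 1) ↪o ℕ, (∀ i, t i < L) ∧ ∀ i j, i < j → g (t j) < g (t i) := by
  classical
  by_cases h : ∃ i < L, IncreasingChain g n i
  · exact Or.inl h
  right
  push Not at h
  -- Label `i` by the length of the longest increasing chain ending there. Equal labels at two
  -- positions exclude an increase between them.
  let f : ℕ → ℕ := fun i => Nat.findGreatest (fun k => IncreasingChain g k i) n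
  have hf : ∀ i, IncreasingChain g (f i) i := fun i =>
    Nat.findGreatest_spec (P := fun k => IncreasingChain g k i) (Nat.zero_le n) trivial
  have hfn : ∀ i < L, f i < n := fun i hi =>
    lt_of_le_of_ne (Nat.findGreatest_le n) fun he => h i hi (he ▸ hf i)
  obtain ⟨y, -, hy⟩ := Finset.exists_lt_card_fiber_of_mul_lt_card_of_maps_to
    (s := Finset.range L) (t := Finset.range n) (f := f) (n := M)
    (fun a ha => by simpa using hfn a (by simpa using ha)) (by simpa using hL)
  obtain ⟨s, hs, hcard⟩ := Finset.exists_subset_card_eq (Nat.succ_le_of_lt hy)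
  have hmem : ∀ i, s.orderEmbOfFin hcard i < L ∧ f (s.orderEmbOfFin hcard i) = y := fun i => by
    simpa using hs (s.orderEmbOfFin_mem hcard i)
  refine ⟨s.orderEmbOfFin hcard, fun i => (hmem i).1, fun i j hij => ?_⟩
  have hlt : s.orderEmbOfFin hcard i < s.orderEmbOfFin hcard j :=
    (s.orderEmbOfFin hcard).lt_iff_lt.mpr hij
  refine lt_of_le_of_ne (not_lt.mp fun hgt => ?_)
    fun he => hlt.ne' (hg (hmem j).1 (hmem i).1 he)
  have hchain : IncreasingChain g (y + 1) (s.orderEmbOfFin hcard j) :=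
    ⟨_, hlt, (hmem i).2 ▸ hf _, hgt⟩
  have h1 : y + 1 ≤ f (s.orderEmbOfFin hcard j) :=
    Nat.le_findGreatest (P := fun k => IncreasingChain g k _)
      (by have := hfn _ (hmem j).1; rw [(hmem j).2] at this; omega) hchain
  rw [(hmem j).2] at h1
  omega

end Chains

/-! ### Prefixes and descent in the ordered free group -/

section Factorization

variable {X : Type*}

theorem take_eq_take_append_drop {A : Type*} (w : List A) {i j : ℕ} (hij : i ≤ j) :
    w.take j = w.take i ++ (w.take j).drop i := by
  conv_lhs => rw [← List.take_append_drop i (w.take j)]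
  rw [List.take_take, min_eq_left hij]

theorem FreeGroup.mk_take_mul_mk_drop (w : List (X × Bool)) {i j : ℕ} (hij : i ≤ j) :
    FreeGroup.mk (w.take i) * FreeGroup.mk ((w.take j).drop i) = FreeGroup.mk (w.take j) := by
  rw [FreeGroup.mul_mk, ← take_eq_take_append_drop w hij]

/-- Distinct prefixes of a reduced word represent distinct elements of the free group. -/
theorem FreeGroup.IsReduced.injOn_mk_take {w : List (X × Bool)} (hw : FreeGroup.IsReduced w) :
    Set.InjOn (fun i => FreeGroup.mk (w.take i)) (Set.Iio (w.length + 1)) := by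
  classical
  intro i hi j hj hij
  have h1 : ∀ k, (FreeGroup.mk (w.take k)).toWord = w.take k := fun k => by
    rw [FreeGroup.toWord_mk]
    exact (hw.infix (List.take_prefix k w).isInfix).reduce_eq
  have h2 := congrArg (fun x => (FreeGroup.toWord x).length) hij
  simp only [h1, List.length_take] at h2
  simp only [Set.mem_Iio] at hi hj
  omega

/-- An increasing chain of prefix values yields consecutive factors greater than `1`. -/
theorem IncreasingChain.exists_factorization [LinearOrder (FreeGroup X)]
    [MulLeftStrictMono (FreeGroup X)] (w : List (X × Bool)) :
    ∀ (n i : ℕ), IncreasingChain (fun i => FreeGroup.mk (w.take i)) n i →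
      ∃ (p : List (X × Bool)) (us : List (List (X × Bool))), us.length = n ∧
        w.take i = p ++ us.flatten ∧ ∀ u ∈ us, (1 : FreeGroup X) < FreeGroup.mk u := by
  intro n
  induction n with
  | zero => exact fun i _ => ⟨w.take i, [], rfl, by simp, by simp⟩
  | succ n ih =>
    rintro i ⟨j, hji, hj, hlt⟩
    obtain ⟨p, us, hlen, hw, hus⟩ := ih j hj
    refine ⟨p, us ++ [(w.take i).drop j], by simp [hlen], ?_, ?_⟩
    · rw [List.flatten_append, ← List.append_assoc, ← hw, List.flatten_singleton]
      exact take_eq_take_append_drop w hji.le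
    · intro u hu
      rcases List.mem_append.mp hu with hu | hu
      · exact hus u hu
      · rw [List.mem_singleton.mp hu]
        have hlt' : FreeGroup.mk (w.take j) < FreeGroup.mk (w.take i) := hlt
        rw [← FreeGroup.mk_take_mul_mk_drop w hji.le] at hlt'
        simpa [-FreeGroup.inv_mk, -FreeGroup.mul_mk] using
          mul_lt_mul_right hlt' (FreeGroup.mk (w.take j))⁻¹

/-- In a well-ordered support, a factor that can be pumped infinitely often is at least `1`. -/
theorem not_mk_lt_one_of_pumping [LinearOrder (FreeGroup X)] [MulLeftStrictMono (FreeGroup X)]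
    [MulRightStrictMono (FreeGroup X)] {L : Set (List (X × Bool))}
    (hL : (FreeGroup.mk '' L).IsWF) (p v s : List (X × Bool))
    (hpump : ∀ k₀ : ℕ, ∃ k ≥ k₀, p ++ (List.replicate k v).flatten ++ s ∈ L) :
    ¬ FreeGroup.mk v < (1 : FreeGroup X) := by
  intro hv
  obtain ⟨φ, hφ, hφL⟩ := Nat.exists_strictMono_subsequence
    (P := fun k => p ++ (List.replicate k v).flatten ++ s ∈ L) fun N => by
      obtain ⟨k, hk, h⟩ := hpump (N + 1)
      exact ⟨k, hk, h⟩
  have hpow : ∀ k : ℕ, FreeGroup.mk (List.replicate k v).flatten = FreeGroup.mk v ^ k := fun k => by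
    rw [FreeGroup.pow_mk]
  refine Set.isWF_iff_no_descending_seq.mp hL
    (fun k => FreeGroup.mk (p ++ (List.replicate (φ k) v).flatten ++ s)) ?_
    fun k => ⟨_, hφL k, rfl⟩
  have hanti : StrictAnti fun k : ℕ => FreeGroup.mk v ^ k := by
    refine strictAnti_nat_of_succ_lt fun k => ?_
    rw [pow_succ]
    exact mul_lt_of_lt_one_right' _ hv
  intro a b hab
  simp only [← FreeGroup.mul_mk, hpow]
  exact mul_lt_mul_left (mul_lt_mul_right (hanti (hφ hab)) _) _

end Factorization

/-! ### The linear representation on right translates -/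

namespace WordSeries

variable {K A : Type*}

theorem rightTranslate_rightTranslate (u v : List A) (S : WordSeries K A) :
    rightTranslate u (rightTranslate v S) = rightTranslate (u ++ v) S := by
  funext w
  simp [rightTranslate]

variable [Field K]

/-- The space spanned by the right translates of `S`. -/
noncomputable abbrev translateSpan (S : WordSeries K A) : Submodule K (WordSeries K A) :=
  LinearMap.range (hankelOperator S)

theorem translateSpan_eq_span (S : WordSeries K A) :
    translateSpan S = Submodule.span K (Set.range fun u : List A => rightTranslate u S) :=
  Finsupp.range_linearCombination K

/-- Right translation by `u` as a linear map. -/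
def rightTranslateLinear (u : List A) : WordSeries K A →ₗ[K] WordSeries K A :=
  LinearMap.funLeft K K (· ++ u)

theorem rightTranslateLinear_apply (u : List A) (T : WordSeries K A) :
    rightTranslateLinear u T = rightTranslate u T := rfl

theorem rightTranslateLinear_mem (S : WordSeries K A) (u : List A) :
    ∀ T ∈ translateSpan S, rightTranslateLinear u T ∈ translateSpan S := by
  rw [translateSpan_eq_span]
  intro T hT
  refine (Submodule.span_le (p := (Submodule.span K _).comap (rightTranslateLinear u))).mpr ?_ hT
  rintro _ ⟨v, rfl⟩
  refine Submodule.subset_span ⟨u ++ v, ?_⟩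
  rw [rightTranslateLinear_apply, rightTranslate_rightTranslate]

/-- Right translation by `u` on the span of the right translates of `S`. -/
noncomputable def translate (S : WordSeries K A) (u : List A) : Module.End K (translateSpan S) :=
  (rightTranslateLinear u).restrict (rightTranslateLinear_mem S u)

theorem coe_translate (S : WordSeries K A) (u : List A) (T : translateSpan S) :
    (translate S u T : WordSeries K A) = rightTranslate u T := rfl

theorem translate_append (S : WordSeries K A) (u v : List A) :
    translate S (u ++ v) = translate S u * translate S v := by
  ext T : 2
  rw [Module.End.mul_apply, coe_translate, coe_translate, coe_translate,
    rightTranslate_rightTranslate]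

theorem translate_nil (S : WordSeries K A) : translate S [] = 1 := by
  ext T w
  simp [coe_translate, rightTranslate]

theorem translate_flatten_replicate (S : WordSeries K A) (u : List A) (k : ℕ) :
    translate S (List.replicate k u).flatten = translate S u ^ k := by
  induction k with
  | zero => simp [translate_nil]
  | succ k ih => rw [List.replicate_succ, List.flatten_cons, translate_append, ih, pow_succ']

/-- The series `S` as an element of the span of its right translates. -/
noncomputable def toTranslateSpan (S : WordSeries K A) : translateSpan S :=
  ⟨S, by
    rw [translateSpan_eq_span]
    exact Submodule.subset_span ⟨[], by funext w; simp [rightTranslate]⟩⟩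

/-- The constant coefficient as a linear form on the span of the right translates of `S`. -/
noncomputable def constantCoeff (S : WordSeries K A) : translateSpan S →ₗ[K] K :=
  (LinearMap.proj []) ∘ₗ (translateSpan S).subtype

/-- Together with `translate_append`, this turns statements about coefficients into statements about
products of operators. -/
theorem constantCoeff_translate (S : WordSeries K A) (w : List A) :
    constantCoeff S (translate S w (toTranslateSpan S)) = S w := rfl

/-- A factor of a word of the support whose translation operator has disjoint kernel and range can
be pumped infinitely often within the support. -/
theorem exists_pumping (S : WordSeries K A) [FiniteDimensional K (translateSpan S)]
    (p v s : List A) (hS : S (p ++ v ++ s) ≠ 0)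
    (hv : Disjoint (LinearMap.ker (translate S v)) (LinearMap.range (translate S v))) (k₀ : ℕ) :
    ∃ k ≥ k₀, p ++ (List.replicate k v).flatten ++ s ∈ Function.support S := by
  obtain ⟨k, hk, h⟩ := exists_apply_pow_ne_zero hv (constantCoeff S ∘ₗ translate S p)
    (translate S s (toTranslateSpan S)) (by
      rw [← constantCoeff_translate S, translate_append, translate_append] at hS
      exact hS) k₀
  refine ⟨k, hk, ?_⟩
  rw [Function.mem_support, ← constantCoeff_translate S, translate_append, translate_append,
    translate_flatten_replicate]
  exact h

/-- In any factorization of a word of the support into sufficiently many nonempty factors, some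
product of consecutive factors acts with disjoint kernel and range. -/
theorem exists_disjoint_ker_range_translate (S : WordSeries K A) {M : ℕ}
    (hM : ∀ E : ℕ → ℕ → Module.End K (translateSpan S),
      (∀ i j k, i ≤ j → j ≤ k → E i k = E i j * E j k) →
      (∀ i j, i < j → j ≤ M → ¬ Disjoint (LinearMap.ker (E i j)) (LinearMap.range (E i j))) →
      E 0 M = 0)
    {w : List A} (hw : S w ≠ 0) (t : Fin (M + 1) ↪o ℕ) :
    ∃ i j, i < j ∧ Disjoint (LinearMap.ker (translate S ((w.take (t j)).drop (t i))))
      (LinearMap.range (translate S ((w.take (t j)).drop (t i)))) := by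
  by_contra! hcon
  -- The cocycle is indexed by all of `ℕ`, so the cut points are frozen after index `M`.
  let τ : ℕ → ℕ := fun i => t ⟨min i M, by omega⟩
  have hτ : Monotone τ := fun i j hij =>
    t.monotone (by rw [Fin.mk_le_mk]; exact min_le_min_right M hij)
  have h0 := hM (fun i j => translate S ((w.take (τ j)).drop (τ i))) ?_ ?_
  · refine hw ?_
    have hsplit : w = w.take (τ 0) ++ (w.take (τ M)).drop (τ 0) ++ w.drop (τ M) := by
      rw [← take_eq_take_append_drop w (hτ (Nat.zero_le M)), List.take_append_drop]
    rw [← constantCoeff_translate S, hsplit, translate_append, translate_append, h0]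
    simp
  · intro i j k hij hjk
    rw [← translate_append]
    congr 1
    -- Cut points may lie beyond the end of `w`, where the factors are empty.
    have hle : τ i ≤ (w.take (τ j)).length ∨ w.length ≤ τ j := by
      have := hτ hij
      rw [List.length_take]
      omega
    rcases hle with hle | hle
    · conv_lhs => rw [take_eq_take_append_drop w (hτ hjk)]
      rw [List.drop_append_of_le_length hle]
    · rw [List.take_of_length_le hle, List.take_of_length_le (hle.trans (hτ hjk)),
        List.drop_of_length_le hle, List.append_nil]
  · intro i j hij hj
    exact hcon _ _ (by rw [Fin.mk_lt_mk]; omega)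

end WordSeries

/-! ### Increase or pumping -/

theorem mainTheorem8 (n c : ℕ) :
    ∃ N : ℕ, ∀ (X : Type*) [Fintype X] (K : Type*) [Field K]
      [LinearOrder (FreeGroup X)] [MulLeftStrictMono (FreeGroup X)]
      [MulRightStrictMono (FreeGroup X)]
      (S : WordSeries K (X × Bool)),
      Fintype.card (X × Bool) = c →
      S.IsRational →
      S.hankelRank = (n : Cardinal) →
      (∀ w ∈ Function.support S, FreeGroup.IsReduced w) →
      (FreeGroup.mk '' Function.support S).IsWF →
      ∀ w ∈ Function.support S, N ≤ w.length →
        ∃ (p s : List (X × Bool)) (us : List (List (X × Bool))),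
          us.length = n ∧ w = p ++ us.flatten ++ s ∧
            ∀ u ∈ us, (1 : FreeGroup X) < FreeGroup.mk u := by
  obtain ⟨M, hM⟩ := exists_forall_cocycle_eq_zero n
  refine ⟨n * M, fun X _ K _ _ _ _ S _ _ hrank hred hwf w hw hlen => ?_⟩
  have hrank' : Module.rank K (S.translateSpan) = n := hrank
  have : FiniteDimensional K S.translateSpan :=
    Module.rank_lt_aleph0_iff.mp (hrank' ▸ Cardinal.natCast_lt_aleph0)
  -- A word of length at least `n * M` has more than `n * M` prefixes, counting the empty one.
  rcases exists_increasingChain_or_strictAnti (fun i => FreeGroup.mk (w.take i))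
    (Nat.lt_succ_of_le hlen) (hred w hw).injOn_mk_take with ⟨i, -, hi⟩ | ⟨t, -, ht⟩
  · obtain ⟨p, us, h1, h2, h3⟩ := hi.exists_factorization
    exact ⟨p, w.drop i, us, h1, by rw [← h2, List.take_append_drop], h3⟩
  · exfalso
    obtain ⟨i, j, hij, hdis⟩ := S.exists_disjoint_ker_range_translate
      (hM K _ (Module.finrank_eq_of_rank_eq hrank')) hw t
    have htij : t i ≤ t j := t.monotone hij.le
    refine not_mk_lt_one_of_pumping hwf _ _ _ (S.exists_pumping (w.take (t i))
      ((w.take (t j)).drop (t i)) (w.drop (t j)) ?_ hdis) ?_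
    · rw [← take_eq_take_append_drop w htij, List.take_append_drop]
      exact hw
    · have hlt : FreeGroup.mk (w.take (t j)) < FreeGroup.mk (w.take (t i)) := ht i j hij
      rw [← FreeGroup.mk_take_mul_mk_drop w htij] at hlt
      simpa [-FreeGroup.inv_mk, -FreeGroup.mul_mk] using
        mul_lt_mul_right hlt (FreeGroup.mk (w.take (t i)))⁻¹
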